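/- Let $s$ be a natural number with $n = 2^s \ge 4$, and let $\mathrm{Tr}$ denote the trace map from $\mathbb{F}_{2^n}$ to $\mathbb{F}_2$. An element $\alpha \in \mathbb{F}_{2^n}$ is called normal over $\mathbb{F}_2$ if $\alpha, \alpha^2, \alpha^{2^2}, \dots, \alpha^{2^{n-1}}$ is a basis of $\mathbb{F}_{2^n}$ over $\mathbb{F}_2$. Its corresponding vector is $(\mathrm{Tr}(\alpha^{1+2^i}))_{0\le i\le n-1} \in \mathbb{F}_2^n$. Let $(a_0, a_1, \dots, a_{n-1}) \in \mathbb{F}_2^n$. Then there exists a normal element of $\mathbb{F}_{2^n}$ over $\mathbb{F}_2$ whose corresponding vector is $(a_0, a_1, \dots, a_{n-1})$ if and only if the following three conditions hold: 1. $a_0 = 1$ and $a_{n/2} = 0$; 2. $a_i = a_{n-i}$ for all $1 \le i \le n/2 - 1$; 3. $\displaystyle\sum_{1 \le i \le n/2-1,\ i \text{ odd}} a_i = 1$ in $\mathbb{F}_2$. -/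

import Mathlib

/-- `α` is a normal element of `K` over the finite field `F` with `q` elements, where `K` has
degree `n` over `F`: the family `α, α ^ q, …, α ^ (q ^ (n - 1))` is a basis of `K` over `F`. -/
def IsNormalElement (F : Type*) {K : Type*} [Field F] [Field K] [Algebra F K]
    (n : ℕ) (α : K) : Prop :=
  LinearIndependent F (fun i : Fin n => α ^ (Nat.card F ^ (i : ℕ))) ∧
    Submodule.span F (Set.range (fun i : Fin n => α ^ (Nat.card F ^ (i : ℕ)))) = ⊤

/-- The corresponding vector (trace self-orthogonal relation) `(a_0, …, a_{n-1})` of `α`,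
where `a_i = Tr (α * α ^ (q ^ i))` and `q` is the number of elements of `F`. -/
noncomputable def correspondingVector (F : Type*) {K : Type*} [Field F] [Field K] [Algebra F K]
    (n : ℕ) (α : K) : Fin n → F :=
  fun i => Algebra.trace F K (α * α ^ (Nat.card F ^ (i : ℕ)))

/-
Let `σ` be the Frobenius automorphism and let `Γ(v, w) = ∑ Tr(v * g w) * g`, summed over the Galois
group `G`, which takes values in the group ring `𝔽₂[G]`. It is sesquilinear for the involution
`f ↦ f*` inverting the elements of `G`, so `Γ(f γ, f γ) = f * f* * Γ(γ, γ)`, and `α` is normal as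
soon as `Γ(α, α)` is a unit. The coefficients of `Γ(α, α)` form the corresponding vector of `α`.

Necessity: a normal element has nonzero trace, and the sum in the third condition is the norm to
`𝔽₂` of the trace of `α` to `𝔽₄`, which is then also nonzero.

Sufficiency: put `w = σ + σ⁻¹`, which is nilpotent since `G` has order `2 ^ s`. The element
`σ ^ i + σ ^ (-i)` is the Dickson polynomial `D i` evaluated at `w`, and `D i ≡ i X` modulo `X ^ 2`
in characteristic two, so a vector satisfying the three conditions gives an element of `𝔽₂[G]`
congruent to `1 + w` modulo `w ^ 2`. Hence the quotient of two such elements is `1 + w * z` with `z`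
nilpotent and symmetric, and this is `f * f*` for `f = 1 + q * (1 + σ)`, where `q + q ^ 2 = z`.
Applying this to `Γ(γ, γ)` for some `γ` of trace one reaches every vector with the three conditions.
-/

open Polynomial Finset

section CharTwo

variable {R : Type*} [CommRing R] [CharP R 2]

theorem exists_add_sq_eq_of_isNilpotent {τ : R →+* R} {z : R} (hz : IsNilpotent z)
    (hτ : τ z = z) : ∃ q, τ q = q ∧ q + q ^ 2 = z := by
  obtain ⟨m, hm⟩ := hz
  refine ⟨∑ j ∈ range m, z ^ 2 ^ j, by simp [hτ], ?_⟩
  have hm' : z ^ 2 ^ m = 0 := pow_eq_zero_of_le m.lt_two_pow_self.le hm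
  have htel := Finset.sum_range_sub' (fun j ↦ z ^ 2 ^ j) m
  rw [CharTwo.sum_sq, ← CharTwo.sub_eq_add, ← Finset.sum_sub_distrib]
  simpa [← pow_mul, ← pow_succ, hm'] using htel

theorem exists_mul_map_eq_one_add_mul {τ : R →+* R} {x y z : R} (hxy : x * y = 1) (hx : τ x = y)
    (hz : IsNilpotent z) (hτz : τ z = z) : ∃ f, f * τ f = 1 + (x + y) * z := by
  obtain ⟨q, hτq, hq⟩ := exists_add_sq_eq_of_isNilpotent hz hτz
  refine ⟨1 + q * (1 + x), ?_⟩
  simp only [map_mul, map_add, map_one, hx, hτq]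
  linear_combination (x + y) * hq + q ^ 2 * hxy + (q + q ^ 2) * CharTwo.two_eq_zero (R := R)

variable {k : Type*} [CommRing k] [Algebra k R]

theorem exists_mul_map_mul_aeval_eq_aeval {τ : R →ₐ[k] R} {x y : R} (hxy : x * y = 1)
    (hx : τ x = y) (hy : τ y = x) (hw : IsNilpotent (x + y)) {P Q : k[X]}
    (hQ : IsUnit (aeval (x + y) Q)) (h0 : P.coeff 0 = Q.coeff 0) (h1 : P.coeff 1 = Q.coeff 1) :
    ∃ f, f * τ f * aeval (x + y) Q = aeval (x + y) P := by
  have hτ (S : k[X]) : τ (aeval (x + y) S) = aeval (x + y) S := by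
    rw [← aeval_algHom_apply, map_add, hx, hy, add_comm]
  obtain ⟨S, hS⟩ : X ^ 2 ∣ P - Q := by
    rw [X_pow_dvd_iff]
    intro d hd
    interval_cases d <;> simp [h0, h1]
  obtain ⟨c, hc⟩ := hQ.exists_right_inv
  have hτc : τ c = c := by
    refine hQ.mul_left_cancel ?_
    rw [hc, ← hτ, ← map_mul, hc, map_one]
  obtain ⟨f, hf⟩ := exists_mul_map_eq_one_add_mul (τ := (τ : R →+* R))
    (z := (x + y) * (aeval (x + y) S * c)) hxy hx ((Commute.all _ _).isNilpotent_mul_right hw)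
    (by simp [hτ, hτc, hx, hy, add_comm])
  refine ⟨f, ?_⟩
  have hPQ : aeval (x + y) P - aeval (x + y) Q = (x + y) ^ 2 * aeval (x + y) S := by
    rw [← map_sub, hS, map_mul, map_pow, aeval_X]
  rw [RingHom.coe_coe] at hf
  rw [hf]
  linear_combination (x + y) ^ 2 * aeval (x + y) S * hc - hPQ

theorem coeff_zero_dickson_one_one (i : ℕ) : (dickson 1 (1 : R) i).coeff 0 = 0 := by
  induction i using Nat.twoStepInduction with
  | zero => norm_num; exact CharTwo.two_eq_zero
  | one => simp
  | more i ih _ => simp [dickson_add_two, ih]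

theorem coeff_one_dickson_one_one (i : ℕ) : (dickson 1 (1 : R) i).coeff 1 = i := by
  induction i using Nat.twoStepInduction with
  | zero => norm_num [coeff_ofNat_succ]
  | one => simp
  | more i ih _ =>
    simp [dickson_add_two, coeff_X_mul, coeff_zero_dickson_one_one, ih, CharTwo.neg_eq,
      CharTwo.two_eq_zero]

end CharTwo

theorem aeval_dickson_one_one_add {k R : Type*} [CommRing k] [CommRing R] [Algebra k R] {x y : R}
    (hxy : x * y = 1) (i : ℕ) : aeval (x + y) (dickson 1 (1 : k) i) = x ^ i + y ^ i := by
  rw [← eval_map_algebraMap, map_dickson, map_one, dickson_one_one_eval_add_inv x y hxy]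

section CyclicSums

variable {G M : Type*} [Group G] [Fintype G] [AddCommMonoid M] {σ : G}

theorem sum_eq_sum_range_orderOf (hσ : ∀ g, g ∈ Subgroup.zpowers σ) (f : G → M) :
    ∑ g, f g = ∑ i ∈ range (orderOf σ), f (σ ^ i) := by
  classical
  rw [← IsCyclic.image_range_orderOf hσ, sum_image (by simpa using pow_injOn_Iio_orderOf)]

theorem sum_add_apply_one {m : ℕ} (hσ : ∀ g, g ∈ Subgroup.zpowers σ) (hm : orderOf σ = 2 * m)
    (f : G → M) :
    ∑ g, f g + f 1 = f (σ ^ m) + ∑ i ∈ range m, (f (σ ^ i) + f (σ ^ i)⁻¹) := by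
  have hpow : σ ^ (m + m) = 1 := by rw [← two_mul, ← hm, pow_orderOf_eq_one]
  have hinv : ∑ i ∈ range (m + 1), f (σ ^ i)⁻¹ = ∑ i ∈ range (m + 1), f (σ ^ (m + i)) := by
    rw [← sum_range_reflect]
    refine sum_congr rfl fun i hi ↦ congrArg f (inv_eq_of_mul_eq_one_right ?_)
    rw [← pow_add, show m + 1 - 1 - i + (m + i) = m + m by grind, hpow]
  have hhalf : (σ ^ m)⁻¹ = σ ^ m := inv_eq_of_mul_eq_one_right (by rw [← pow_add, hpow])
  rw [sum_range_succ, sum_range_succ, hhalf, hpow] at hinv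
  rw [sum_eq_sum_range_orderOf hσ, hm, two_mul, sum_range_add, sum_add_distrib, add_assoc, ← hinv]
  abel

end CyclicSums

section GroupRingElement

open MonoidAlgebra

theorem charP_groupRing {k G : Type*} [CommSemiring k] [Monoid G] (p : ℕ) [CharP k p] :
    CharP k[G] p :=
  charP_of_injective_algebraMap (FaithfulSMul.algebraMap_injective k k[G]) p

variable {k G : Type*} [Semiring k] [Fintype G]

/-- The element `∑ g, A g * g` of the group ring with coefficient function `A`. -/
noncomputable def groupRingElement (A : G → k) : k[G] :=
  ∑ g, single g (A g)

theorem coeff_groupRingElement (A : G → k) (g : G) : (groupRingElement A).coeff g = A g := by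
  classical
  simp [groupRingElement, MonoidAlgebra.coeff_sum, Finsupp.single_apply]

theorem groupRingElement_injective :
    Function.Injective (groupRingElement : (G → k) → k[G]) := fun A B h ↦ by
  ext g
  rw [← coeff_groupRingElement A, h, coeff_groupRingElement]

end GroupRingElement

section IsAdmissible

variable {k G : Type*} [Semiring k] [Group G]

/-- The three conditions on a vector `(a₀, …, aₙ₋₁)` with `n = 4 * l`, read as conditions on the
function `σ ^ i ↦ aᵢ` on a cyclic group of order `n` with generator `σ`. -/
structure IsAdmissible (σ : G) (l : ℕ) (A : G → k) : Prop where
  apply_one : A 1 = 1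
  apply_half : A (σ ^ (2 * l)) = 0
  apply_inv (g : G) : A g⁻¹ = A g
  sum_odd : ∑ j ∈ range l, A (σ ^ (2 * j + 1)) = 1

end IsAdmissible

section GroupRing

open MonoidAlgebra

variable {k G : Type*} [CommRing k] [CommGroup G]

/-- The canonical involution of the group ring `k[G]`, inverting the group elements. -/
noncomputable def groupRingInv : k[G] →ₐ[k] k[G] :=
  mapDomainAlgHom k k (invMonoidHom : G →* G)

theorem groupRingInv_single (g : G) (c : k) : groupRingInv (single g c) = single g⁻¹ c := by
  simp [groupRingInv]

/-- The expansion of a symmetric element `∑ g, A g * g` of the group ring of a cyclic group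
`⟨σ⟩` of order `2 * m` as a polynomial in `σ + σ⁻¹`, in characteristic two. The term `C (A 1)`
corrects the summand `i = 0`, which vanishes because `dickson 1 1 0 = 2`. -/
noncomputable def symmetricPolynomial (σ : G) (m : ℕ) (A : G → k) : k[X] :=
  C (A 1) + ∑ i ∈ range m, C (A (σ ^ i)) * dickson 1 1 i

variable [CharP k 2] {σ : G} {A : G → k}

theorem coeff_zero_symmetricPolynomial (m : ℕ) : (symmetricPolynomial σ m A).coeff 0 = A 1 := by
  simp [symmetricPolynomial, coeff_zero_dickson_one_one]

theorem coeff_one_symmetricPolynomial (l : ℕ) :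
    (symmetricPolynomial σ (2 * l) A).coeff 1 = ∑ j ∈ range l, A (σ ^ (2 * j + 1)) := by
  have hcoeff (m : ℕ) :
      (symmetricPolynomial σ m A).coeff 1 = ∑ i ∈ range m, A (σ ^ i) * i := by
    simp [symmetricPolynomial, coeff_one_dickson_one_one]
  rw [hcoeff]
  induction l with
  | zero => simp
  | succ l ih =>
    rw [mul_add_one, sum_range_succ, sum_range_succ, ih, sum_range_succ]
    simp [CharTwo.two_eq_zero]

theorem aeval_symmetricPolynomial [Fintype G] {m : ℕ} (hσ : ∀ g, g ∈ Subgroup.zpowers σ)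
    (hm : orderOf σ = 2 * m) (hinv : ∀ g, A g⁻¹ = A g) (hhalf : A (σ ^ m) = 0) :
    aeval (of k G σ + of k G σ⁻¹) (symmetricPolynomial σ m A) = groupRingElement A := by
  have := charP_groupRing (k := k) (G := G) 2
  have hmul : of k G σ * of k G σ⁻¹ = 1 := by rw [← map_mul, mul_inv_cancel, map_one]
  have hpair (i : ℕ) : algebraMap k k[G] (A (σ ^ i)) * (of k G σ ^ i + of k G σ⁻¹ ^ i) =
      single (σ ^ i) (A (σ ^ i)) + single (σ ^ i)⁻¹ (A (σ ^ i)⁻¹) := by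
    simp [mul_add, single_pow, hinv]
  have hsum := sum_add_apply_one hσ hm fun g ↦ single g (A g)
  simp only [hhalf, single_zero, zero_add, ← hpair] at hsum
  simp only [symmetricPolynomial, map_add, map_sum, map_mul, aeval_C,
    aeval_dickson_one_one_add hmul]
  rw [← hsum, coe_algebraMap, add_comm, add_assoc]
  simp [groupRingElement, CharTwo.add_self_eq_zero]

theorem isNilpotent_of_add_of_inv {s : ℕ} (hσ : orderOf σ = 2 ^ s) :
    IsNilpotent (of k G σ + of k G σ⁻¹) := by
  have := charP_groupRing (k := k) (G := G) 2
  refine ⟨2 ^ s, ?_⟩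
  rw [add_pow_char_pow, ← map_pow, ← map_pow, inv_pow, ← hσ, pow_orderOf_eq_one, inv_one,
    CharTwo.add_self_eq_zero]

variable [Fintype G]

theorem IsAdmissible.isUnit_groupRingElement {l s : ℕ} (hA : IsAdmissible σ l A)
    (hσ : ∀ g, g ∈ Subgroup.zpowers σ) (hl : orderOf σ = 2 * (2 * l)) (hs : orderOf σ = 2 ^ s) :
    IsUnit (groupRingElement A) := by
  rw [← aeval_symmetricPolynomial hσ hl hA.apply_inv hA.apply_half]
  refine isUnit_aeval_of_isUnit_aeval_of_isNilpotent_sub (b := 0) ?_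
    (by simpa using isNilpotent_of_add_of_inv hs)
  rw [← coeff_zero_eq_aeval_zero', coeff_zero_symmetricPolynomial, hA.apply_one, map_one]
  exact isUnit_one

theorem IsAdmissible.exists_mul_groupRingInv_mul_eq {B : G → k} {l s : ℕ}
    (hA : IsAdmissible σ l A) (hB : IsAdmissible σ l B) (hσ : ∀ g, g ∈ Subgroup.zpowers σ)
    (hl : orderOf σ = 2 * (2 * l)) (hs : orderOf σ = 2 ^ s) :
    ∃ f, f * groupRingInv f * groupRingElement B = groupRingElement A := by
  have := charP_groupRing (k := k) (G := G) 2
  have hunit := hB.isUnit_groupRingElement hσ hl hs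
  rw [← aeval_symmetricPolynomial hσ hl hB.apply_inv hB.apply_half] at hunit ⊢
  rw [← aeval_symmetricPolynomial hσ hl hA.apply_inv hA.apply_half]
  refine exists_mul_map_mul_aeval_eq_aeval ?_ ?_ ?_ (isNilpotent_of_add_of_inv hs) hunit ?_ ?_
  · rw [← map_mul, mul_inv_cancel, map_one]
  · simp [groupRingInv_single]
  · simp [groupRingInv_single]
  · simp_rw [coeff_zero_symmetricPolynomial, hA.apply_one, hB.apply_one]
  · simp_rw [coeff_one_symmetricPolynomial, hA.sum_odd, hB.sum_odd]

end GroupRing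

section Gram

open MonoidAlgebra

variable {k G V : Type*} [CommRing k] [CommGroup G] [Fintype G] [AddCommGroup V] [Module k V]

/-- The `k[G]`-valued pairing `∑ g, B v (g w) * g` attached to a bilinear form `B` on a
representation of `G`. It is sesquilinear over `k[G]` when `B` is `G`-invariant. -/
noncomputable def gram (ρ : Representation k G V) (B : LinearMap.BilinForm k V) (v w : V) : k[G] :=
  groupRingElement fun g ↦ B v (ρ g w)

variable {ρ : Representation k G V} {B : LinearMap.BilinForm k V}

theorem gram_asAlgebraHom_left (hB : ∀ g v w, B (ρ g v) (ρ g w) = B v w) (f : k[G]) (v w : V) :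
    gram ρ B (ρ.asAlgebraHom f v) w = f * gram ρ B v w := by
  induction f using MonoidAlgebra.induction_linear with
  | zero => simp [gram, groupRingElement]
  | add f₁ f₂ h₁ h₂ =>
    simp only [add_mul, ← h₁, ← h₂]
    simp [gram, groupRingElement, sum_add_distrib]
  | single h c =>
    simp only [gram, groupRingElement, mul_sum, single_mul_single]
    rw [← Equiv.sum_comp (Equiv.mulLeft h)]
    simp [hB]

theorem gram_asAlgebraHom_right (f : k[G]) (v w : V) :
    gram ρ B v (ρ.asAlgebraHom f w) = groupRingInv f * gram ρ B v w := by
  induction f using MonoidAlgebra.induction_linear with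
  | zero => simp [gram, groupRingElement]
  | add f₁ f₂ h₁ h₂ =>
    simp only [map_add, add_mul, ← h₁, ← h₂]
    simp [gram, groupRingElement, sum_add_distrib]
  | single h c =>
    simp only [gram, groupRingElement, groupRingInv_single, mul_sum, single_mul_single]
    symm
    rw [← Equiv.sum_comp (Equiv.mulLeft h)]
    simp [mul_comm h]

theorem linearIndependent_of_isUnit_gram (hB : ∀ g v w, B (ρ g v) (ρ g w) = B v w) {v : V}
    (hv : IsUnit (gram ρ B v v)) : LinearIndependent k fun g ↦ ρ g v := by
  rw [Fintype.linearIndependent_iff]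
  intro c hc
  have hcv : ρ.asAlgebraHom (groupRingElement c) v = 0 := by
    simpa [groupRingElement] using hc
  have hmul := gram_asAlgebraHom_left hB (groupRingElement c) v v
  rw [hcv, eq_comm, show gram ρ B 0 v = 0 by simp [gram, groupRingElement],
    hv.mul_left_eq_zero] at hmul
  exact congrFun (groupRingElement_injective (hmul.trans (by simp [groupRingElement])))

end Gram

section PeriodicSequences

variable {M R : Type*} [AddCommMonoid M] [CommSemiring R]

theorem sum_range_add_eq_of_periodic {f : ℕ → M} {m : ℕ} (hf : Function.Periodic f m) (j : ℕ) :
    ∑ i ∈ range m, f (i + j) = ∑ i ∈ range m, f i := by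
  induction j with
  | zero => rfl
  | succ j ih =>
    rw [← ih]
    obtain _ | m := m
    · rfl
    · rw [sum_range_succ, sum_range_succ', show m + (j + 1) = j + (m + 1) by ring, hf, zero_add]
      simp only [add_right_comm, add_assoc]

theorem sum_range_two_mul (f : ℕ → M) (m : ℕ) :
    ∑ i ∈ range (2 * m), f i = ∑ j ∈ range m, (f (2 * j) + f (2 * j + 1)) := by
  induction m with
  | zero => rfl
  | succ m ih => rw [mul_add_one, sum_range_succ, sum_range_succ, ih, sum_range_succ, add_assoc]

theorem sum_range_two_mul_reflect (f : ℕ → M) (l : ℕ) :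
    ∑ k ∈ range (2 * l), f k = ∑ k ∈ range l, (f k + f (2 * l - 1 - k)) := by
  rw [sum_add_distrib, two_mul, sum_range_add, ← sum_range_reflect (fun k ↦ f (l + k))]
  exact congrArg _ (sum_congr rfl fun k hk ↦ congrArg f (by grind))

theorem sum_sum_mul_add_odd_of_periodic {x : ℕ → R} {l : ℕ}
    (hx : Function.Periodic x (2 * (2 * l))) :
    ∑ k ∈ range l, ∑ i ∈ range (2 * (2 * l)), x i * x (i + (2 * k + 1)) =
      (∑ j ∈ range (2 * l), x (2 * j)) * ∑ j ∈ range (2 * l), x (2 * j + 1) := by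
  have hodd : Function.Periodic (fun j ↦ x (2 * j + 1)) (2 * l) := fun j ↦ by
    simp [mul_add, add_right_comm _ _ 1, hx _]
  let u (k : ℕ) : R := ∑ j ∈ range (2 * l), x (2 * j) * x (2 * j + (2 * k + 1))
  have hreflect {k : ℕ} (hk : k < l) :
      ∑ j ∈ range (2 * l), x (2 * j + 1) * x (2 * j + 1 + (2 * k + 1)) = u (2 * l - 1 - k) := by
    have hperiod : Function.Periodic
        (fun j ↦ x (2 * j) * x (2 * j + (2 * (2 * l - 1 - k) + 1))) (2 * l) := fun j ↦ by
      simp only [mul_add, add_right_comm _ (2 * (2 * l)), hx _]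
    refine Eq.trans (sum_congr rfl fun j _ ↦ ?_) (sum_range_add_eq_of_periodic hperiod (k + 1))
    rw [mul_comm, show 2 * (j + (k + 1)) + (2 * (2 * l - 1 - k) + 1) = 2 * j + 1 + 2 * (2 * l) by
      lia, hx, show 2 * j + 1 + (2 * k + 1) = 2 * (j + (k + 1)) by ring]
  calc
    _ = ∑ k ∈ range l, (u k + u (2 * l - 1 - k)) := by
      refine sum_congr rfl fun k hk ↦ ?_
      rw [sum_range_two_mul, sum_add_distrib, hreflect (mem_range.1 hk)]
    _ = ∑ k ∈ range (2 * l), u k := (sum_range_two_mul_reflect u l).symm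
    _ = _ := by
      rw [sum_comm, sum_mul]
      refine sum_congr rfl fun j _ ↦ ?_
      rw [← mul_sum, ← sum_range_add_eq_of_periodic hodd j]
      simp only [mul_add, add_comm, add_left_comm]

end PeriodicSequences

section Galois

variable {F K : Type*} [Field F] [Field K] [Algebra F K]

/-- The function `g ↦ Tr(α * g α)` on the Galois group. At the powers of the Frobenius of a finite
field it takes the entries of the corresponding vector of `α`. -/
noncomputable def traceAutocorrelation (F : Type*) {K : Type*} [Field F] [Field K] [Algebra F K]
    (α : K) (g : Gal(K/F)) : F :=
  Algebra.trace F K (α * g α)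

theorem traceAutocorrelation_inv (α : K) (g : Gal(K/F)) :
    traceAutocorrelation F α g⁻¹ = traceAutocorrelation F α g := by
  rw [traceAutocorrelation, ← Algebra.trace_eq_of_algEquiv g, map_mul, mul_comm]
  simp [traceAutocorrelation]

variable [FiniteDimensional F K] [IsGalois F K]

theorem traceAutocorrelation_eq_zero_of_mul_self [CharP K 2] (α : K) {τ : Gal(K/F)} (hτ : τ ≠ 1)
    (hττ : τ * τ = 1) : traceAutocorrelation F α τ = 0 := by
  apply (algebraMap F K).injective
  rw [traceAutocorrelation, trace_eq_sum_automorphisms, map_zero]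
  have hsymm (g : Gal(K/F)) : (g * τ) (α * τ α) = g (α * τ α) := by
    simp [mul_comm, ← AlgEquiv.mul_apply, mul_assoc, hττ]
  refine sum_involution (fun g _ ↦ g * τ) (fun g _ ↦ ?_) (fun g _ _ ↦ by simpa) (by simp)
    (fun g _ ↦ by simp [mul_assoc, hττ])
  rw [hsymm, CharTwo.add_self_eq_zero]

variable {σ : Gal(K/F)}

theorem algebraMap_trace_eq_sum_range (hσ : ∀ g, g ∈ Subgroup.zpowers σ) (α : K) :
    algebraMap F K (Algebra.trace F K α) = ∑ i ∈ range (orderOf σ), (σ ^ i) α := by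
  rw [trace_eq_sum_automorphisms, sum_eq_sum_range_orderOf hσ]

theorem sum_traceAutocorrelation_odd_ne_zero {l : ℕ} (hσ : ∀ g, g ∈ Subgroup.zpowers σ)
    (hl : orderOf σ = 2 * (2 * l)) {α : K} (hα : Algebra.trace F K α ≠ 0) :
    ∑ k ∈ range l, traceAutocorrelation F α (σ ^ (2 * k + 1)) ≠ 0 := by
  have hper : Function.Periodic (fun i ↦ (σ ^ i) α) (2 * (2 * l)) := fun i ↦ by
    simp [pow_add, ← hl, pow_orderOf_eq_one]
  -- `e` is the trace of `α` to the quadratic subextension, and `e * σ e` is the norm of `e`.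
  let e := ∑ j ∈ range (2 * l), (σ ^ (2 * j)) α
  have hσe : ∑ j ∈ range (2 * l), (σ ^ (2 * j + 1)) α = σ e := by simp [e, pow_succ']
  have htrace : algebraMap F K (Algebra.trace F K α) = e + σ e := by
    rw [algebraMap_trace_eq_sum_range hσ, hl, sum_range_two_mul, sum_add_distrib, hσe]
  have hprod : algebraMap F K (∑ k ∈ range l, traceAutocorrelation F α (σ ^ (2 * k + 1))) =
      e * σ e := by
    rw [← hσe, ← sum_sum_mul_add_odd_of_periodic hper, map_sum]
    refine sum_congr rfl fun k _ ↦ ?_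
    rw [traceAutocorrelation, algebraMap_trace_eq_sum_range hσ, hl]
    simp [pow_add]
  have he : e ≠ 0 := by
    intro he
    simp [he, hα] at htrace
  rw [← (algebraMap F K).injective.ne_iff, hprod, map_zero]
  exact mul_ne_zero he (by simpa)

end Galois

section PrimeField

variable {K : Type*} [Field K] [Finite K] [Algebra (ZMod 2) K] {σ : Gal(K/(ZMod 2))} {l s : ℕ}

theorem isAdmissible_traceAutocorrelation (hσ : ∀ g, g ∈ Subgroup.zpowers σ)
    (hl : orderOf σ = 2 * (2 * l)) {α : K} (hα : Algebra.trace (ZMod 2) K α ≠ 0) :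
    IsAdmissible σ l (traceAutocorrelation (ZMod 2) α) where
  apply_one := by
    have hfrob := Algebra.trace_eq_of_algEquiv
      (FiniteField.frobeniusAlgEquivOfAlgebraic (ZMod 2) K) α
    rw [FiniteField.frobeniusAlgEquivOfAlgebraic_apply, ZMod.card, sq] at hfrob
    exact hfrob.trans (Fin.eq_one_of_ne_zero _ hα)
  apply_half := by
    have : CharP K 2 := charP_of_injective_algebraMap (algebraMap (ZMod 2) K).injective 2
    have hpos : 0 < orderOf σ := orderOf_pos σ
    refine traceAutocorrelation_eq_zero_of_mul_self α (pow_ne_one_of_lt_orderOf ?_ ?_) ?_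
    · lia
    · lia
    · rw [← pow_add, ← two_mul, ← hl, pow_orderOf_eq_one]
  apply_inv := traceAutocorrelation_inv α
  sum_odd := Fin.eq_one_of_ne_zero _ (sum_traceAutocorrelation_odd_ne_zero hσ hl hα)

open scoped IsMulCommutative in
theorem IsAdmissible.exists_traceAutocorrelation_eq {A : Gal(K/(ZMod 2)) → ZMod 2}
    (hA : IsAdmissible σ l A) (hσ : ∀ g, g ∈ Subgroup.zpowers σ) (hl : orderOf σ = 2 * (2 * l))
    (hs : orderOf σ = 2 ^ s) :
    ∃ α : K, traceAutocorrelation (ZMod 2) α = A ∧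
      LinearIndependent (ZMod 2) fun g : Gal(K/(ZMod 2)) ↦ g α := by
  let ρ := Representation.ofDistribMulAction (ZMod 2) Gal(K/(ZMod 2)) K
  have hinv (g : Gal(K/(ZMod 2))) (v w : K) : Algebra.traceForm (ZMod 2) K (ρ g v) (ρ g w) =
      Algebra.traceForm (ZMod 2) K v w := by
    simpa [ρ, Algebra.traceForm_apply] using Algebra.trace_eq_of_algEquiv g (v * w)
  obtain ⟨γ, hγ⟩ := Algebra.trace_surjective (ZMod 2) K 1
  have hγ := isAdmissible_traceAutocorrelation hσ hl (hγ.trans_ne one_ne_zero)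
  obtain ⟨f, hf⟩ := hA.exists_mul_groupRingInv_mul_eq hγ hσ hl hs
  have hgram : gram ρ (Algebra.traceForm (ZMod 2) K) (ρ.asAlgebraHom f γ) (ρ.asAlgebraHom f γ) =
      groupRingElement A := by
    rw [gram_asAlgebraHom_left hinv, gram_asAlgebraHom_right, ← mul_assoc]
    exact hf
  refine ⟨ρ.asAlgebraHom f γ, groupRingElement_injective hgram, ?_⟩
  exact linearIndependent_of_isUnit_gram hinv (hgram ▸ hA.isUnit_groupRingElement hσ hl hs)

end PrimeField

section Frobenius

variable {F K : Type*} [Field F] [Fintype F] [Field K] [Algebra F K]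

theorem frobeniusAlgEquivOfAlgebraic_pow_apply [Algebra.IsAlgebraic F K] (i : ℕ) (α : K) :
    (FiniteField.frobeniusAlgEquivOfAlgebraic F K ^ i) α = α ^ Nat.card F ^ i := by
  rw [AlgEquiv.coe_pow, FiniteField.coe_frobeniusAlgEquivOfAlgebraic_iterate,
    Fintype.card_eq_nat_card]

theorem correspondingVector_apply [Algebra.IsAlgebraic F K] {n : ℕ} (α : K) (i : Fin n) :
    correspondingVector F n α i =
      traceAutocorrelation F α (FiniteField.frobeniusAlgEquivOfAlgebraic F K ^ (i : ℕ)) := by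
  rw [correspondingVector, traceAutocorrelation, frobeniusAlgEquivOfAlgebraic_pow_apply]

theorem mem_zpowers_frobeniusAlgEquivOfAlgebraic [Finite K] (g : Gal(K/F)) :
    g ∈ Subgroup.zpowers (FiniteField.frobeniusAlgEquivOfAlgebraic F K) := by
  obtain ⟨i, rfl⟩ := (FiniteField.bijective_frobeniusAlgEquivOfAlgebraic_pow F K).2 g
  exact Subgroup.npow_mem_zpowers _ _

end Frobenius

section NormalElement

variable {F K : Type*} [Field F] [Field K] [Finite K] [Algebra F K] {α : K}

theorem IsNormalElement.trace_ne_zero (hα : IsNormalElement F (Module.finrank F K) α) :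
    Algebra.trace F K α ≠ 0 := by
  intro htrace
  have hsum := FiniteField.algebraMap_trace_eq_sum_pow F K α
  rw [htrace, map_zero, sum_range] at hsum
  exact one_ne_zero (Fintype.linearIndependent_iff.1 hα.1 (fun _ ↦ 1) (by simpa using hsum.symm)
    ⟨0, Module.finrank_pos⟩)

theorem isNormalElement_of_linearIndependent (hα : LinearIndependent F fun g : Gal(K/F) ↦ g α) :
    IsNormalElement F (Module.finrank F K) α := by
  have : Finite F := .of_injective _ (algebraMap F K).injective
  have := Fintype.ofFinite F
  have hlin := hα.comp _ (FiniteField.bijective_frobeniusAlgEquivOfAlgebraic_pow F K).1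
  simp only [Function.comp_def, frobeniusAlgEquivOfAlgebraic_pow_apply] at hlin
  exact ⟨hlin, hlin.span_eq_top_of_card_eq_finrank' (Fintype.card_fin _)⟩

theorem finrank_eq_of_natCard_eq_pow {n : ℕ} (hK : Nat.card K = Nat.card F ^ n) :
    Module.finrank F K = n := by
  have : Finite F := .of_injective _ (algebraMap F K).injective
  rw [Module.natCard_eq_pow_finrank (K := F)] at hK
  exact Nat.pow_right_injective Finite.one_lt_card hK

end NormalElement

section Coordinates

variable {G : Type*} [Group G] {σ : G}

theorem exists_le_half_eq_pow_or_eq_inv_pow {m : ℕ} (hσ : ∀ g, g ∈ Subgroup.zpowers σ)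
    (hm : orderOf σ = 2 * m) (hpos : 0 < m) (g : G) :
    ∃ i ≤ m, g = σ ^ i ∨ g = (σ ^ i)⁻¹ := by
  classical
  have hfin : IsOfFinOrder σ := orderOf_pos_iff.1 (by lia)
  obtain ⟨i, hi, rfl⟩ := mem_image.1 (hfin.mem_zpowers_iff_mem_range_orderOf.1 (hσ g))
  obtain him | him := le_total i m
  · exact ⟨i, him, .inl rfl⟩
  · refine ⟨2 * m - i, by lia, .inr (eq_inv_of_mul_eq_one_left ?_)⟩
    rw [← pow_add, Nat.add_sub_cancel' (by grind), ← hm, pow_orderOf_eq_one]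

theorem forall_apply_inv_eq_iff {M : Type*} {m : ℕ} (hσ : ∀ g, g ∈ Subgroup.zpowers σ)
    (hm : orderOf σ = 2 * m) (hpos : 0 < m) (A : G → M) :
    (∀ g, A g⁻¹ = A g) ↔ ∀ i, 1 ≤ i → i ≤ m - 1 → A (σ ^ i) = A (σ ^ (2 * m - i)) := by
  have hinv {i : ℕ} (hi : i ≤ m) : (σ ^ i)⁻¹ = σ ^ (2 * m - i) := by
    refine inv_eq_of_mul_eq_one_right ?_
    rw [← pow_add, Nat.add_sub_cancel' (by lia), ← hm, pow_orderOf_eq_one]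
  refine ⟨fun h i _ hi ↦ by rw [← hinv (by lia), h], fun h g ↦ ?_⟩
  have hpow {i : ℕ} (hi : i ≤ m) : A (σ ^ i)⁻¹ = A (σ ^ i) := by
    obtain rfl | rfl | hi : i = 0 ∨ i = m ∨ 1 ≤ i ∧ i ≤ m - 1 := by lia
    · simp
    · rw [hinv hi, two_mul, Nat.add_sub_cancel]
    · rw [hinv (by lia), h i hi.1 hi.2]
  obtain ⟨i, hi, rfl | rfl⟩ := exists_le_half_eq_pow_or_eq_inv_pow hσ hm hpos g
  · exact hpow hi
  · rw [inv_inv, hpow hi]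

theorem sum_filter_coprime_two_eq {M : Type*} [AddCommMonoid M] {n l : ℕ} (hn : n = 2 * (2 * l))
    (b : ℕ → M) :
    ∑ i ∈ univ.filter
        (fun i : Fin n ↦ 1 ≤ (i : ℕ) ∧ (i : ℕ) ≤ n / 2 - 1 ∧ Nat.Coprime (i : ℕ) 2), b i =
      ∑ j ∈ range l, b (2 * j + 1) := by
  refine (sum_bij (fun j hj ↦ ⟨2 * j + 1, by grind⟩) ?_ ?_ ?_ fun _ _ ↦ rfl).symm
  · simp only [mem_filter, Nat.coprime_two_right]
    grind
  · grind
  · simp only [mem_filter, mem_univ, true_and, mem_range, Nat.coprime_two_right]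
    rintro i ⟨_, hi, j, hj⟩
    exact ⟨j, by lia, Fin.ext hj.symm⟩

theorem isAdmissible_iff {k : Type*} [Semiring k] {n l : ℕ} (hσ : ∀ g, g ∈ Subgroup.zpowers σ)
    (horder : orderOf σ = n) (hn : n = 2 * (2 * l)) (hpos : 0 < n) {A : G → k} {a : Fin n → k}
    (ha : ∀ i : Fin n, a i = A (σ ^ (i : ℕ))) :
    IsAdmissible σ l A ↔ (a ⟨0, hpos⟩ = 1 ∧ a ⟨n / 2, Nat.div_lt_self hpos one_lt_two⟩ = 0) ∧
      (∀ i j : Fin n, 1 ≤ (i : ℕ) → (i : ℕ) ≤ n / 2 - 1 → (j : ℕ) = n - (i : ℕ) → a i = a j) ∧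
      ∑ i ∈ univ.filter
        (fun i : Fin n ↦ 1 ≤ (i : ℕ) ∧ (i : ℕ) ≤ n / 2 - 1 ∧ Nat.Coprime (i : ℕ) 2), a i = 1 := by
  have hhalf : n / 2 = 2 * l := by lia
  have hsymm : (∀ g, A g⁻¹ = A g) ↔ ∀ i j : Fin n, 1 ≤ (i : ℕ) → (i : ℕ) ≤ n / 2 - 1 →
      (j : ℕ) = n - (i : ℕ) → a i = a j := by
    rw [forall_apply_inv_eq_iff hσ (horder.trans hn) (by lia), hhalf, ← hn]
    refine ⟨fun h i j hi hi' hj ↦ ?_, fun h i hi hi' ↦ ?_⟩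
    · rw [ha, ha, hj, h i hi hi']
    · simpa only [ha] using h ⟨i, by lia⟩ ⟨n - i, by lia⟩ hi hi' rfl
  have hodd := sum_filter_coprime_two_eq hn fun i ↦ A (σ ^ i)
  simp only [← ha] at hodd
  rw [← hsymm, hodd, ha, ha, pow_zero]
  simp only [hhalf]
  exact ⟨fun h ↦ ⟨⟨h.1, h.2⟩, h.3, h.4⟩, fun h ↦ ⟨h.1.1, h.1.2, h.2.1, h.2.2⟩⟩

end Coordinates

theorem mainTheorem1 (n s : ℕ) (hns : n = 2 ^ s) (hn : 4 ≤ n)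
    (K : Type*) [Field K] [Algebra (ZMod 2) K] (hK : Nat.card K = 2 ^ n)
    (a : Fin n → ZMod 2) :
    (∃ α : K, IsNormalElement (ZMod 2) n α ∧ correspondingVector (ZMod 2) n α = a) ↔
      (a ⟨0, by omega⟩ = 1 ∧ a ⟨n / 2, by omega⟩ = 0) ∧
      (∀ i j : Fin n, 1 ≤ (i : ℕ) → (i : ℕ) ≤ n / 2 - 1 → (j : ℕ) = n - (i : ℕ) → a i = a j) ∧
      (∑ i ∈ Finset.univ.filter
        (fun i : Fin n => 1 ≤ (i : ℕ) ∧ (i : ℕ) ≤ n / 2 - 1 ∧ Nat.Coprime (i : ℕ) 2), a i) = 1 := by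
  obtain ⟨l, hl⟩ : ∃ l, n = 2 * (2 * l) := by
    rcases s with _ | _ | r
    exacts [by lia, by lia, ⟨2 ^ r, by rw [hns]; ring⟩]
  have : Finite K := Nat.finite_of_card_ne_zero (by simp [hK])
  obtain rfl : Module.finrank (ZMod 2) K = n := finrank_eq_of_natCard_eq_pow (by simpa using hK)
  let σ := FiniteField.frobeniusAlgEquivOfAlgebraic (ZMod 2) K
  have hσ : ∀ g, g ∈ Subgroup.zpowers σ := mem_zpowers_frobeniusAlgEquivOfAlgebraic
  have horder := FiniteField.orderOf_frobeniusAlgEquivOfAlgebraic (ZMod 2) K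
  have hbij := FiniteField.bijective_frobeniusAlgEquivOfAlgebraic_pow (ZMod 2) K
  obtain ⟨A, hA⟩ : ∃ A : Gal(K/(ZMod 2)) → ZMod 2, ∀ i : Fin _, a i = A (σ ^ (i : ℕ)) :=
    ⟨Function.extend _ a 0, fun i ↦ (hbij.1.extend_apply a 0 i).symm⟩
  rw [← isAdmissible_iff hσ horder hl (by lia) hA]
  constructor
  · rintro ⟨α, hα, rfl⟩
    obtain rfl : traceAutocorrelation (ZMod 2) α = A := by
      ext g
      obtain ⟨i, rfl⟩ := hbij.2 g
      exact (correspondingVector_apply α i).symm.trans (hA i)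
    exact isAdmissible_traceAutocorrelation hσ (horder.trans hl) hα.trace_ne_zero
  · intro hadm
    obtain ⟨α, rfl, hlin⟩ :=
      hadm.exists_traceAutocorrelation_eq hσ (horder.trans hl) (horder.trans hns)
    exact ⟨α, isNormalElement_of_linearIndependent hlin,
      funext fun i ↦ (correspondingVector_apply α i).trans (hA i).symm⟩
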